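/- Let $X_1,X_2$ be independent and uniformly distributed on $[0,1)$, and let $f(x_1,x_2)=1$ if $x_1\ge x_2$ and $f(x_1,x_2)=0$ if $x_1<x_2$, for $(x_1,x_2)\in[0,1)^2$. A combinatorial rectangle is a product $A\times B$ in which each of $A$ and $B$ is a countable union of intervals of $\mathbb{R}$ (degenerate and empty intervals are allowed). A zero-error rectangular partition $(\mathcal P,\mathcal Q)$ consists of two countable families of pairwise disjoint combinatorial rectangles, those of $\mathcal P$ contained in $f^{-1}(1)$ and those of $\mathcal Q$ contained in $f^{-1}(0)$, whose union contains $(X_1,X_2)$ with probability one. Its entropy is $-\sum_i p_i\log_2 p_i-\sum_i q_i\log_2 q_i\in[0,\infty]$, where $p_i$ and $q_i$ are the probabilities of the cells of $\mathcal P$ and of $\mathcal Q$. Theorem. If a zero-error rectangular partition $(\mathcal P,\mathcal Q)$ has the smallest entropy among all zero-error rectangular partitions, then there are $u,v$ with $0<u<1$ and $0<v<1$ such that, up to sets of Lebesgue measure zero, some cell of $\mathcal P$ is the rectangle $[v,1]\times[0,v]$, with opposite vertices $(1,0)$ and $(v,v)$, and some cell of $\mathcal Q$ is the rectangle $[0,u]\times[u,1]$,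 with opposite vertices $(0,1)$ and $(u,u)$. More precisely, each of these two closed rectangles is the closure of the corresponding cell, and exceeds it only by a set of measure zero. -/

import Mathlib

open Set MeasureTheory
open scoped ENNReal

noncomputable section

namespace ComparisonPartition

/-- The unit square `[0,1) × [0,1)` in which the pair `(X₁, X₂)` lives. -/
def unitSquare : Set (ℝ × ℝ) := Ico (0 : ℝ) 1 ×ˢ Ico (0 : ℝ) 1

/-- The comparison classifier for two nodes with weights `+1, -1` and threshold `0`:
the value is `1` if `x₁ - x₂ ≥ 0` and `0` if `x₁ - x₂ < 0`. -/
def classifier (x : ℝ × ℝ) : ℕ := if 0 ≤ x.1 - x.2 then 1 else 0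

/-- The part `{x : f x = c}` of the unit square on which the classifier takes the value `c`. -/
def classRegion (c : ℕ) : Set (ℝ × ℝ) := {x ∈ unitSquare | classifier x = c}

/-- The law of `(X₁, X₂)`, with `X₁, X₂` independent and uniformly distributed on `[0,1)`. -/
def law : Measure (ℝ × ℝ) :=
  (volume.restrict (Ico (0 : ℝ) 1)).prod (volume.restrict (Ico (0 : ℝ) 1))

/-- A countable union of intervals of the real line. An interval is an order-connected set: it may
be open, closed or half-open, may be a single point, and may be empty. -/
def IsUnionOfIntervals (A : Set ℝ) : Prop :=
  ∃ I : ℕ → Set ℝ, (∀ n, (I n).OrdConnected) ∧ A = ⋃ n, I n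

/-- A combinatorial rectangle: the Cartesian product of two unions of intervals. -/
def IsCombRectangle (R : Set (ℝ × ℝ)) : Prop :=
  ∃ A B : Set ℝ, IsUnionOfIntervals A ∧ IsUnionOfIntervals B ∧ R = A ×ˢ B

/-- A zero-error rectangular partition `(𝒫, 𝒬)` of the unit square. The two countable families
`P 0, P 1, …` and `Q 0, Q 1, …` consist of pairwise disjoint combinatorial rectangles, the first
inside the region where the classifier is `1`, the second inside the region where it is `0`, and
together they cover the unit square with probability one. Empty cells are allowed, so finite
families are included; an empty cell contributes nothing to the entropy. (A countable family
cannot cover every point of the diagonal: each zero-error rectangle has at most one point there.) -/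
structure ZeroErrorPartition where
  P : ℕ → Set (ℝ × ℝ)
  Q : ℕ → Set (ℝ × ℝ)
  rect_P : ∀ i, IsCombRectangle (P i)
  rect_Q : ∀ i, IsCombRectangle (Q i)
  sub_P : ∀ i, P i ⊆ classRegion 1
  sub_Q : ∀ i, Q i ⊆ classRegion 0
  disjoint_P : ∀ i j, i ≠ j → Disjoint (P i) (P j)
  disjoint_Q : ∀ i j, i ≠ j → Disjoint (Q i) (Q j)
  cover : ∀ᵐ x ∂law, x ∈ (⋃ i, P i) ∪ ⋃ i, Q i

/-- The contribution `-p log₂ p` (in bits) of a cell of probability `p`; it is `0` for `p = 0`. -/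
def cellEntropy (R : Set (ℝ × ℝ)) : ℝ≥0∞ :=
  ENNReal.ofReal (-(law.real R * Real.logb 2 (law.real R)))

/-- The entropy of a partition, in bits, as a sum of nonnegative terms with values in `[0, ∞]`. -/
def ZeroErrorPartition.entropy (𝒮 : ZeroErrorPartition) : ℝ≥0∞ :=
  ∑' i, cellEntropy (𝒮.P i) + ∑' i, cellEntropy (𝒮.Q i)

/-- `𝒮` has the smallest entropy among all zero-error rectangular partitions. -/
def ZeroErrorPartition.MinimizesEntropy (𝒮 : ZeroErrorPartition) : Prop :=
  ∀ 𝒮' : ZeroErrorPartition, 𝒮.entropy ≤ 𝒮'.entropy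

/-- `R` is the axis-parallel rectangle with opposite vertices `a` and `b`, up to a null set. Here
`uIcc a b` is the closed axis-parallel rectangle with these opposite vertices; `R` lies in it, fills
it except for a set of Lebesgue measure zero, and has it as its closure. -/
def IsRectangleWithVertices (R : Set (ℝ × ℝ)) (a b : ℝ × ℝ) : Prop :=
  closure R = uIcc a b ∧ volume (uIcc a b \ R) = 0

end ComparisonPartition

end

namespace ComparisonPartition

/-! ### The entropy inequality -/

/-! The entropy is the sum of the contributions of the two triangles, and reflection in the diagonal
carries `𝒬` to the triangle of `𝒫`; so it suffices to treat one triangle, with `r` equal to `≤` or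
`<`. Let `F k` be a cell of largest probability, with second side `B`, and let `v = sSup B`. Up to
null sets `maxRect r B` is `[v,1] × [0,v]`, and it contains `F k`. Replace `F k` by `maxRect r B`
and remove `maxRect r B` from every other cell. The remainders are still combinatorial rectangles
(`isCombRectangle_diff_maxRect`), and mass has moved only from other cells to the largest one. By
concavity of `-p log p` this strictly lowers a finite entropy unless no mass moved
(`tsum_negMulLog_lt`). Hence in an optimal partition `F k` already fills `maxRect r B` up to a null
set. The minimum is finite because the dyadic partition has finite entropy
(`entropy_dyadicFamily_ne_top`). -/

theorem negMulLog_le_tangent {p q : ℝ} (hp : 0 < p) (hq : 0 ≤ q) :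
    Real.negMulLog q ≤ Real.negMulLog p + (-Real.log p - 1) * (q - p) := by
  rcases hq.eq_or_lt with rfl | hq
  · simp only [Real.negMulLog]; nlinarith
  have h := Real.log_le_sub_one_of_pos (div_pos hp hq)
  rw [Real.log_div hp.ne' hq.ne'] at h
  have h2 := mul_le_mul_of_nonneg_left h hq.le
  have h3 : q * (p / q - 1) = p - q := by field_simp
  simp only [Real.negMulLog]
  nlinarith

theorem negMulLog_lt_tangent {p q : ℝ} (hp : 0 < p) (hq : p < q) :
    Real.negMulLog q < Real.negMulLog p + (-Real.log p - 1) * (q - p) := by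
  have hq0 : 0 < q := hp.trans hq
  have h := Real.log_lt_sub_one_of_pos (div_pos hp hq0) (by
    rw [Ne, div_eq_one_iff_eq hq0.ne']; exact hq.ne)
  rw [Real.log_div hp.ne' hq0.ne'] at h
  have h2 := mul_lt_mul_of_pos_left h hq0
  have h3 : q * (p / q - 1) = p - q := by field_simp
  simp only [Real.negMulLog]
  nlinarith

/-- The tangent slope `-log p - 1` decreases in `p`; since `q - p ≤ 0`, passing to the slope at the
larger point `m` only weakens the bound. -/
theorem negMulLog_le_tangent_of_le {p q m : ℝ} (hq : 0 ≤ q) (hqp : q ≤ p) (hpm : p ≤ m) :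
    Real.negMulLog q ≤ Real.negMulLog p + (-Real.log m - 1) * (q - p) := by
  rcases (hq.trans hqp).eq_or_lt with rfl | hp
  · obtain rfl : q = 0 := le_antisymm hqp hq
    simp
  have h := negMulLog_le_tangent hp hq
  have := Real.log_le_log hp hpm
  nlinarith

/-- Moving mass from the other atoms to the largest atom lowers the entropy. -/
theorem tsum_negMulLog_lt {p q : ℕ → ℝ} {k : ℕ} (hq0 : ∀ i, 0 ≤ q i) (hq1 : ∀ i, q i ≤ 1)
    (hpk : 0 < p k) (hmax : ∀ i, p i ≤ p k) (hle : ∀ i, i ≠ k → q i ≤ p i) (hlt : p k < q k)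
    (hp : Summable p) (hq : Summable q) (hsum : ∑' i, p i = ∑' i, q i)
    (hh : Summable fun i => Real.negMulLog (p i)) :
    (Summable fun i => Real.negMulLog (q i)) ∧
      ∑' i, Real.negMulLog (q i) < ∑' i, Real.negMulLog (p i) := by
  -- One slope, that of the tangent at the largest atom, serves for all indices; the linear terms `c
  -- * (q i - p i)` then sum to zero because the total mass is unchanged.
  set c := -Real.log (p k) - 1
  have hb : ∀ i, Real.negMulLog (q i) ≤ Real.negMulLog (p i) + c * (q i - p i) := by
    intro i
    by_cases hi : i = k
    · subst hi; exact (negMulLog_lt_tangent hpk hlt).le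
    · exact negMulLog_le_tangent_of_le (hq0 i) (hle i hi) (hmax i)
  have hs : Summable fun i => Real.negMulLog (p i) + c * (q i - p i) :=
    hh.add ((hq.sub hp).mul_left c)
  have hs' : Summable fun i => Real.negMulLog (q i) :=
    Summable.of_nonneg_of_le (fun i => Real.negMulLog_nonneg (hq0 i) (hq1 i)) hb hs
  refine ⟨hs', (hs'.tsum_lt_tsum hb (negMulLog_lt_tangent hpk hlt) hs).trans_eq ?_⟩
  rw [hh.tsum_add ((hq.sub hp).mul_left c), tsum_mul_left, hq.tsum_sub hp, hsum]
  simp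

theorem exists_forall_le_of_summable {p : ℕ → ℝ} (hp : Summable p) {j : ℕ} (hj : 0 < p j) :
    ∃ k, 0 < p k ∧ ∀ i, p i ≤ p k := by
  have hfin : {i | p j ≤ p i}.Finite := by
    have h := hp.tendsto_cofinite_zero.eventually (gt_mem_nhds hj)
    rw [Filter.eventually_cofinite] at h
    simpa using h
  obtain ⟨k, hk, hmax⟩ := Set.exists_max_image _ p hfin ⟨j, le_refl (p j)⟩
  refine ⟨k, hj.trans_le hk, fun i => ?_⟩
  rcases le_total (p j) (p i) with h | h
  · exact hmax i h
  · exact h.trans hk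

/-! ### The law and the cells -/

theorem law_eq : law = volume.restrict unitSquare := by
  rw [law, Measure.prod_restrict]; rfl

instance : IsProbabilityMeasure law := by
  have : IsProbabilityMeasure (volume.restrict (Ico (0 : ℝ) 1)) := ⟨by simp⟩
  unfold law; infer_instance

theorem measurableSet_unitSquare : MeasurableSet unitSquare :=
  measurableSet_Ico.prod measurableSet_Ico

theorem measurePreserving_swap_law : MeasurePreserving Prod.swap law law :=
  ⟨measurable_swap, by unfold law; exact Measure.prod_swap⟩

theorem law_preimage_swap (R : Set (ℝ × ℝ)) : law (Prod.swap ⁻¹' R) = law R :=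
  measurePreserving_swap_law.measure_preimage_equiv (f := MeasurableEquiv.prodComm) R

theorem cellEntropy_preimage_swap (R : Set (ℝ × ℝ)) :
    cellEntropy (Prod.swap ⁻¹' R) = cellEntropy R := by
  simp only [cellEntropy, measureReal_def, law_preimage_swap]

theorem cellEntropy_eq (R : Set (ℝ × ℝ)) :
    cellEntropy R = ENNReal.ofReal (Real.negMulLog (law.real R) / Real.log 2) := by
  rw [cellEntropy, Real.negMulLog, Real.logb]
  congr 1; ring

theorem negMulLog_law_nonneg (R : Set (ℝ × ℝ)) : 0 ≤ Real.negMulLog (law.real R) :=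
  Real.negMulLog_nonneg measureReal_nonneg measureReal_le_one

theorem IsUnionOfIntervals.measurableSet {A : Set ℝ} (h : IsUnionOfIntervals A) :
    MeasurableSet A := by
  obtain ⟨I, hI, rfl⟩ := h
  exact MeasurableSet.iUnion fun n => (hI n).measurableSet

theorem isUnionOfIntervals_of_ordConnected {A : Set ℝ} (h : A.OrdConnected) :
    IsUnionOfIntervals A := ⟨fun _ => A, fun _ => h, (iUnion_const A).symm⟩

theorem IsUnionOfIntervals.inter_ordConnected {A J : Set ℝ} (h : IsUnionOfIntervals A)
    (hJ : J.OrdConnected) : IsUnionOfIntervals (A ∩ J) := by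
  obtain ⟨I, hI, rfl⟩ := h
  exact ⟨fun n => I n ∩ J, fun n => (hI n).inter hJ, iUnion_inter _ _⟩

theorem IsCombRectangle.measurableSet {R : Set (ℝ × ℝ)} (h : IsCombRectangle R) :
    MeasurableSet R := by
  obtain ⟨A, B, hA, hB, rfl⟩ := h
  exact hA.measurableSet.prod hB.measurableSet

theorem IsCombRectangle.preimage_swap {R : Set (ℝ × ℝ)} (h : IsCombRectangle R) :
    IsCombRectangle (Prod.swap ⁻¹' R) := by
  obtain ⟨A, B, hA, hB, rfl⟩ := h
  exact ⟨B, A, hB, hA, preimage_swap_prod _ _⟩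

theorem isCombRectangle_empty : IsCombRectangle ∅ :=
  ⟨∅, ∅, isUnionOfIntervals_of_ordConnected ordConnected_empty,
    isUnionOfIntervals_of_ordConnected ordConnected_empty, by simp⟩

theorem mem_classRegion_one {x : ℝ × ℝ} : x ∈ classRegion 1 ↔ x ∈ unitSquare ∧ x.2 ≤ x.1 := by
  simp [classRegion, classifier]

theorem mem_classRegion_zero {x : ℝ × ℝ} : x ∈ classRegion 0 ↔ x ∈ unitSquare ∧ x.1 < x.2 := by
  simp [classRegion, classifier]

theorem swap_mem_unitSquare {x : ℝ × ℝ} : x.swap ∈ unitSquare ↔ x ∈ unitSquare := by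
  simp [unitSquare, and_comm]

theorem law_diagonal : ∀ᵐ x ∂law, x.1 ≠ x.2 := by
  rw [ae_iff]
  have hm : MeasurableSet {x : ℝ × ℝ | ¬ x.1 ≠ x.2} := by
    simpa using measurableSet_eq_fun measurable_fst measurable_snd
  rw [law, Measure.measure_prod_null hm]
  refine Filter.Eventually.of_forall fun a => ?_
  have : Prod.mk a ⁻¹' {x : ℝ × ℝ | ¬ x.1 ≠ x.2} = {a} := by ext b; simp [eq_comm]
  change volume.restrict (Ico (0 : ℝ) 1) (Prod.mk a ⁻¹' {x : ℝ × ℝ | ¬ x.1 ≠ x.2}) = 0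
  rw [this]; simp

/-! ### Families of rectangles below the diagonal -/

/-- Pairwise disjoint rectangles inside `{x | r x.2 x.1}` that cover the open triangle below the
diagonal up to a null set; here `r` is `≤` or `<`. -/
structure IsTrianglePartition (r : ℝ → ℝ → Prop) (F : ℕ → Set (ℝ × ℝ)) : Prop where
  rect : ∀ i, IsCombRectangle (F i)
  sub : ∀ i, ∀ x ∈ F i, x ∈ unitSquare ∧ r x.2 x.1
  disj : ∀ i j, i ≠ j → Disjoint (F i) (F j)
  cover : ∀ᵐ x ∂law, x.2 < x.1 → x ∈ ⋃ i, F i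

theorem ZeroErrorPartition.isTrianglePartition_P (𝒮 : ZeroErrorPartition) :
    IsTrianglePartition (· ≤ ·) 𝒮.P where
  rect := 𝒮.rect_P
  sub i x hx := mem_classRegion_one.1 (𝒮.sub_P i hx)
  disj := 𝒮.disjoint_P
  cover := by
    filter_upwards [𝒮.cover] with x hx hlt
    refine hx.resolve_right fun h => ?_
    obtain ⟨i, hi⟩ := mem_iUnion.1 h
    exact lt_asymm hlt (mem_classRegion_zero.1 (𝒮.sub_Q i hi)).2

theorem ZeroErrorPartition.isTrianglePartition_Q (𝒮 : ZeroErrorPartition) :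
    IsTrianglePartition (· < ·) fun i => Prod.swap ⁻¹' 𝒮.Q i where
  rect i := (𝒮.rect_Q i).preimage_swap
  sub i x hx := by
    have := mem_classRegion_zero.1 (𝒮.sub_Q i hx)
    exact ⟨swap_mem_unitSquare.1 this.1, this.2⟩
  disj i j hij := (𝒮.disjoint_Q i j hij).preimage _
  cover := by
    filter_upwards [measurePreserving_swap_law.quasiMeasurePreserving.ae 𝒮.cover] with x hx hlt
    rw [← preimage_iUnion]
    refine hx.resolve_left fun h => ?_
    obtain ⟨i, hi⟩ := mem_iUnion.1 h
    exact (mem_classRegion_one.1 (𝒮.sub_P i hi)).2.not_gt hlt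

/-- The partition of the square assembled from partitions of its two triangles. -/
def ofTriangles {F G : ℕ → Set (ℝ × ℝ)} (hF : IsTrianglePartition (· ≤ ·) F)
    (hG : IsTrianglePartition (· < ·) G) : ZeroErrorPartition where
  P := F
  Q i := Prod.swap ⁻¹' G i
  rect_P := hF.rect
  rect_Q i := (hG.rect i).preimage_swap
  sub_P i x hx := mem_classRegion_one.2 (hF.sub i x hx)
  sub_Q i x hx := by
    have := hG.sub i _ hx
    exact mem_classRegion_zero.2 ⟨swap_mem_unitSquare.1 this.1, this.2⟩
  disjoint_P := hF.disj
  disjoint_Q i j hij := (hG.disj i j hij).preimage _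
  cover := by
    filter_upwards [measurePreserving_swap_law.quasiMeasurePreserving.ae hG.cover, hF.cover,
      law_diagonal] with x h1 h2 h3
    rcases lt_or_gt_of_ne h3 with h | h
    · right; rw [← preimage_iUnion]; exact h1 h
    · exact Or.inl (h2 h)

theorem entropy_ofTriangles {F G : ℕ → Set (ℝ × ℝ)} (hF : IsTrianglePartition (· ≤ ·) F)
    (hG : IsTrianglePartition (· < ·) G) :
    (ofTriangles hF hG).entropy = ∑' i, cellEntropy (F i) + ∑' i, cellEntropy (G i) := by
  simp [ZeroErrorPartition.entropy, ofTriangles, cellEntropy_preimage_swap]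

theorem ZeroErrorPartition.entropy_eq (𝒮 : ZeroErrorPartition) :
    𝒮.entropy = ∑' i, cellEntropy (𝒮.P i) + ∑' i, cellEntropy (Prod.swap ⁻¹' 𝒮.Q i) := by
  simp [ZeroErrorPartition.entropy, cellEntropy_preimage_swap]

/-! ### Enlarging one cell to a maximal rectangle -/

section Enlarge

variable {r : ℝ → ℝ → Prop}

theorem rel_of_rel_of_le (hle : ∀ b a, r b a → b ≤ a) (hlt : ∀ b a, b < a → r b a) {a b c : ℝ}
    (h : r b a) (hac : a ≤ c) : r b c := by
  rcases hac.eq_or_lt with rfl | hac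
  · exact h
  · exact hlt _ _ ((hle _ _ h).trans_lt hac)

theorem rel_of_le_of_rel (hle : ∀ b a, r b a → b ≤ a) (hlt : ∀ b a, b < a → r b a) {a b c : ℝ}
    (hcb : c ≤ b) (h : r b a) : r c a := by
  rcases hcb.eq_or_lt with rfl | hcb
  · exact h
  · exact hlt _ _ (hcb.trans_le (hle _ _ h))

/-- The points that can stand to the left of every point of `B`. -/
def upperPart (r : ℝ → ℝ → Prop) (B : Set ℝ) : Set ℝ := {a | ∀ b ∈ B, r b a}

/-- The points below every point of `[0,1)` in `upperPart r B`. -/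
def lowerPart (r : ℝ → ℝ → Prop) (B : Set ℝ) : Set ℝ :=
  {b | ∀ a ∈ Ico (0 : ℝ) 1 ∩ upperPart r B, r b a}

theorem isUpperSet_upperPart (hle : ∀ b a, r b a → b ≤ a) (hlt : ∀ b a, b < a → r b a)
    (B : Set ℝ) : IsUpperSet (upperPart r B) :=
  fun _ _ hac ha b hb => rel_of_rel_of_le hle hlt (ha b hb) hac

theorem isLowerSet_lowerPart (hle : ∀ b a, r b a → b ≤ a) (hlt : ∀ b a, b < a → r b a)
    (B : Set ℝ) : IsLowerSet (lowerPart r B) :=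
  fun _ _ hcb hb a ha => rel_of_le_of_rel hle hlt hcb (hb a ha)

/-- The maximal rectangle with second side containing `B`. -/
def maxRect (r : ℝ → ℝ → Prop) (B : Set ℝ) : Set (ℝ × ℝ) :=
  (Ico 0 1 ∩ upperPart r B) ×ˢ (Ico 0 1 ∩ lowerPart r B)

theorem isCombRectangle_maxRect (hle : ∀ b a, r b a → b ≤ a) (hlt : ∀ b a, b < a → r b a)
    (B : Set ℝ) : IsCombRectangle (maxRect r B) :=
  ⟨_, _, isUnionOfIntervals_of_ordConnected
      (ordConnected_Ico.inter (isUpperSet_upperPart hle hlt B).ordConnected),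
    isUnionOfIntervals_of_ordConnected
      (ordConnected_Ico.inter (isLowerSet_lowerPart hle hlt B).ordConnected), rfl⟩

/-- A rectangle `C × D` in the triangle cannot stick out of `maxRect r B` on both sides: either `D`
lies in `lowerPart r B`, and only `C` is trimmed, or `C` lies in `upperPart r B`, and only `D` is
trimmed. -/
theorem isCombRectangle_diff_maxRect (hle : ∀ b a, r b a → b ≤ a) (hlt : ∀ b a, b < a → r b a)
    (B : Set ℝ) {R : Set (ℝ × ℝ)} (hR : IsCombRectangle R)
    (hsub : ∀ x ∈ R, x ∈ unitSquare ∧ r x.2 x.1) : IsCombRectangle (R \ maxRect r B) := by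
  obtain ⟨C, D, hC, hD, rfl⟩ := hR
  have hu := isUpperSet_upperPart hle hlt B
  have hl := isLowerSet_lowerPart hle hlt B
  by_cases h : D ⊆ lowerPart r B
  · refine ⟨C ∩ (upperPart r B)ᶜ, D, hC.inter_ordConnected hu.compl.ordConnected, hD, ?_⟩
    ext x
    constructor
    · rintro ⟨hx, hn⟩
      have hs := (hsub x hx).1
      exact ⟨⟨hx.1, fun hxu => hn ⟨⟨hs.1, hxu⟩, hs.2, h hx.2⟩⟩, hx.2⟩
    · rintro ⟨⟨h1, h2⟩, h3⟩
      exact ⟨⟨h1, h3⟩, fun hn => h2 hn.1.2⟩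
  · obtain ⟨d, hd, hdl⟩ := not_subset.1 h
    obtain ⟨a, ha, hra⟩ : ∃ a ∈ Ico (0 : ℝ) 1 ∩ upperPart r B, ¬ r d a := by
      simpa [lowerPart, and_assoc] using hdl
    -- Every `c ∈ C` satisfies `a ≤ d ≤ c`, so `c` inherits membership in the upper set from `a`.
    have had : a ≤ d := not_lt.1 fun h => hra (hlt _ _ h)
    have hCu : C ⊆ upperPart r B := fun c hc =>
      hu (had.trans (hle _ _ (hsub (c, d) ⟨hc, hd⟩).2)) ha.2
    refine ⟨C, D ∩ (lowerPart r B)ᶜ, hC, hD.inter_ordConnected hl.compl.ordConnected, ?_⟩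
    ext x
    constructor
    · rintro ⟨hx, hn⟩
      have hs := (hsub x hx).1
      exact ⟨hx.1, hx.2, fun hxl => hn ⟨⟨hs.1, hCu hx.1⟩, hs.2, hxl⟩⟩
    · rintro ⟨h1, h2, h3⟩
      exact ⟨⟨h1, h2⟩, fun hn => h3 hn.2.2⟩

theorem IsTrianglePartition.enlarge (hle : ∀ b a, r b a → b ≤ a) (hlt : ∀ b a, b < a → r b a)
    {F : ℕ → Set (ℝ × ℝ)} (hF : IsTrianglePartition r F) (k : ℕ) (B : Set ℝ)
    (hk : F k ⊆ maxRect r B) :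
    IsTrianglePartition r
      (Function.update (fun i => F i \ maxRect r B) k (maxRect r B)) where
  rect i := by
    by_cases hi : i = k
    · subst hi; simpa using isCombRectangle_maxRect hle hlt B
    · simpa [hi] using isCombRectangle_diff_maxRect hle hlt B (hF.rect i) (hF.sub i)
  sub i x hx := by
    by_cases hi : i = k
    · subst hi
      simp only [Function.update_self] at hx
      exact ⟨⟨hx.1.1, hx.2.1⟩, hx.2.2 _ hx.1⟩
    · simp only [Function.update_of_ne hi] at hx
      exact hF.sub i x hx.1
  disj i j hij := by
    by_cases hi : i = k
    · subst hi
      simpa [hij.symm] using disjoint_sdiff_right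
    · by_cases hj : j = k
      · subst hj
        simpa [hij] using disjoint_sdiff_left
      · simpa [hi, hj] using (hF.disj i j hij).mono sdiff_subset sdiff_subset
  cover := by
    filter_upwards [hF.cover] with x hx hlt
    obtain ⟨i, hi⟩ := mem_iUnion.1 (hx hlt)
    by_cases hm : x ∈ maxRect r B
    · exact mem_iUnion.2 ⟨k, by simpa using hm⟩
    · refine mem_iUnion.2 ⟨i, ?_⟩
      have hik : i ≠ k := by rintro rfl; exact hm (hk hi)
      simpa [hik] using ⟨hi, hm⟩

theorem IsTrianglePartition.measurableSet {F : ℕ → Set (ℝ × ℝ)} (hF : IsTrianglePartition r F)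
    (i : ℕ) : MeasurableSet (F i) := (hF.rect i).measurableSet

theorem IsTrianglePartition.ae_eq (hle : ∀ b a, r b a → b ≤ a) {F : ℕ → Set (ℝ × ℝ)}
    (hF : IsTrianglePartition r F) : (⋃ i, F i) =ᵐ[law] {x | x.2 < x.1} := by
  filter_upwards [hF.cover, law_diagonal] with x h1 h2
  refine propext ⟨fun h => ?_, h1⟩
  obtain ⟨i, hi⟩ := mem_iUnion.1 h
  exact lt_of_le_of_ne (hle _ _ (hF.sub i x hi).2) h2.symm

/-- The total is the same for every partition of the triangle, which gives the conservation of mass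
used when two partitions are compared. -/
theorem IsTrianglePartition.hasSum_law (hle : ∀ b a, r b a → b ≤ a) {F : ℕ → Set (ℝ × ℝ)}
    (hF : IsTrianglePartition r F) :
    HasSum (fun i => law.real (F i)) (law.real {x | x.2 < x.1}) := by
  rw [← measureReal_congr (hF.ae_eq hle)]
  have h := measure_iUnion (μ := law) (fun i j hij => hF.disj i j hij) hF.measurableSet
  have hne : ∑' i, law (F i) ≠ ⊤ := h ▸ measure_ne_top _ _
  rw [measureReal_def, h, ENNReal.tsum_toReal_eq (fun i => measure_ne_top _ _)]
  exact (ENNReal.summable_toReal hne).hasSum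

theorem law_triangle_pos : 0 < law.real {x | x.2 < x.1} := by
  have hsub : Ico (1 / 2 : ℝ) 1 ×ˢ Ico (0 : ℝ) (1 / 2) ⊆ {x | x.2 < x.1} :=
    fun x hx => hx.2.2.trans_le hx.1.1
  refine lt_of_lt_of_le ?_ (measureReal_mono hsub (measure_ne_top _ _))
  rw [measureReal_def, law, Measure.prod_prod, Measure.restrict_apply measurableSet_Ico,
    Measure.restrict_apply measurableSet_Ico, Ico_inter_Ico, Ico_inter_Ico]
  norm_num [ENNReal.toReal_mul]

end Enlarge

/-! ### The largest cell of an optimal partition -/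

section Optimal

variable {r : ℝ → ℝ → Prop}

theorem summable_negMulLog_of_entropy_ne_top {F : ℕ → Set (ℝ × ℝ)}
    (h : ∑' i, cellEntropy (F i) ≠ ⊤) :
    Summable fun i => Real.negMulLog (law.real (F i)) := by
  have hs := ENNReal.summable_toReal h
  have hl : (0 : ℝ) < Real.log 2 := Real.log_pos one_lt_two
  refine (hs.mul_right (Real.log 2)).congr fun i => ?_
  rw [cellEntropy_eq, ENNReal.toReal_ofReal (div_nonneg (negMulLog_law_nonneg _) hl.le),
    div_mul_cancel₀ _ hl.ne']

theorem tsum_cellEntropy {F : ℕ → Set (ℝ × ℝ)}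
    (h : Summable fun i => Real.negMulLog (law.real (F i))) :
    ∑' i, cellEntropy (F i) =
      ENNReal.ofReal ((∑' i, Real.negMulLog (law.real (F i))) / Real.log 2) := by
  have hl : (0 : ℝ) < Real.log 2 := Real.log_pos one_lt_two
  simp only [cellEntropy_eq]
  rw [← tsum_div_const, ENNReal.ofReal_tsum_of_nonneg
    (fun i => div_nonneg (negMulLog_law_nonneg _) hl.le) (h.div_const _)]

/-- In an entropy-minimizing partition of the triangle, a cell of largest probability fills every
maximal rectangle that contains it. -/
theorem IsTrianglePartition.law_maxRect_le (hle : ∀ b a, r b a → b ≤ a)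
    (hlt : ∀ b a, b < a → r b a) {F : ℕ → Set (ℝ × ℝ)} (hF : IsTrianglePartition r F)
    (hfin : ∑' i, cellEntropy (F i) ≠ ⊤)
    (hmin : ∀ G, IsTrianglePartition r G → ∑' i, cellEntropy (F i) ≤ ∑' i, cellEntropy (G i))
    {k : ℕ} (hpos : 0 < law.real (F k)) (hmax : ∀ i, law.real (F i) ≤ law.real (F k))
    {B : Set ℝ} (hk : F k ⊆ maxRect r B) : law.real (maxRect r B) ≤ law.real (F k) := by
  by_contra! hgt
  have hG := hF.enlarge hle hlt k B hk
  set G := Function.update (fun i => F i \ maxRect r B) k (maxRect r B)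
  have hsF := hF.hasSum_law hle
  have hsG := hG.hasSum_law hle
  have hGk : G k = maxRect r B := Function.update_self ..
  have hGi : ∀ i, i ≠ k → G i ⊆ F i := fun i hi => by
    simp [G, hi]
  obtain ⟨hs, hl⟩ := tsum_negMulLog_lt (p := fun i => law.real (F i))
    (q := fun i => law.real (G i)) (k := k) (fun i => measureReal_nonneg)
    (fun i => measureReal_le_one) hpos hmax
    (fun i hi => measureReal_mono (hGi i hi) (measure_ne_top _ _)) (by rwa [hGk])
    hsF.summable hsG.summable (hsF.tsum_eq.trans hsG.tsum_eq.symm)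
    (summable_negMulLog_of_entropy_ne_top hfin)
  have h := hmin G hG
  rw [tsum_cellEntropy hs, tsum_cellEntropy (summable_negMulLog_of_entropy_ne_top hfin)] at h
  have hl2 : (0 : ℝ) < Real.log 2 := Real.log_pos one_lt_two
  rw [ENNReal.ofReal_le_ofReal_iff
    (div_nonneg (tsum_nonneg fun i => negMulLog_law_nonneg _) hl2.le),
    div_le_div_iff_of_pos_right hl2] at h
  exact hl.not_ge h

theorem isRectangleWithVertices_of_null {R : Set (ℝ × ℝ)} {v : ℝ} (h0 : 0 < v) (h1 : v < 1)
    (hsub : R ⊆ Icc v 1 ×ˢ Icc 0 v) (hnull : volume ((Ioo v 1 ×ˢ Ioo 0 v) \ R) = 0) :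
    IsRectangleWithVertices R (1, 0) (v, v) := by
  have hu : uIcc ((1 : ℝ), (0 : ℝ)) (v, v) = Icc v 1 ×ˢ Icc 0 v := by
    rw [← uIcc_prod_uIcc, uIcc_of_ge h1.le, uIcc_of_le h0.le]
  rw [IsRectangleWithVertices, hu]
  have hO : IsOpen (Ioo v 1 ×ˢ Ioo 0 v) := isOpen_Ioo.prod isOpen_Ioo
  refine ⟨(closure_minimal hsub (isClosed_Icc.prod isClosed_Icc)).antisymm ?_, ?_⟩
  · have hcl : Ioo v 1 ×ˢ Ioo 0 v ⊆ closure R := by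
      -- The part of the open rectangle outside `closure R` is open and null, hence empty.
      rw [← sdiff_eq_empty, ← (hO.sdiff isClosed_closure).measure_eq_zero_iff volume]
      exact measure_mono_null (sdiff_subset_sdiff_right subset_closure) hnull
    have := closure_minimal hcl isClosed_closure
    rwa [closure_prod_eq, closure_Ioo h1.ne, closure_Ioo h0.ne] at this
  · have hae : (Ioo v 1 ×ˢ Ioo 0 v : Set (ℝ × ℝ)) =ᵐ[volume] Icc v 1 ×ˢ Icc 0 v :=
      Measure.set_prod_ae_eq Ioo_ae_eq_Icc Ioo_ae_eq_Icc
    rwa [← measure_congr (hae.diff (ae_eq_refl R))]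

/-- An entropy-minimizing partition of the triangle below the diagonal has a rectangular cell with
opposite vertices at the corner `(1, 0)` and on the diagonal. -/
theorem IsTrianglePartition.exists_isRectangleWithVertices (hle : ∀ b a, r b a → b ≤ a)
    (hlt : ∀ b a, b < a → r b a) {F : ℕ → Set (ℝ × ℝ)} (hF : IsTrianglePartition r F)
    (hfin : ∑' i, cellEntropy (F i) ≠ ⊤)
    (hmin : ∀ G, IsTrianglePartition r G → ∑' i, cellEntropy (F i) ≤ ∑' i, cellEntropy (G i)) :
    ∃ v : ℝ, (0 < v ∧ v < 1) ∧ ∃ i, IsRectangleWithVertices (F i) (1, 0) (v, v) := by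
  have hsum := hF.hasSum_law hle
  obtain ⟨j, hj⟩ : ∃ j, 0 < law.real (F j) := by
    by_contra! h
    exact absurd (hsum.tsum_eq ▸ tsum_nonpos h) law_triangle_pos.not_ge
  obtain ⟨k, hpos, hmax⟩ := exists_forall_le_of_summable hsum.summable hj
  obtain ⟨A, B, -, -, hAB⟩ := hF.rect k
  have hmem : ∀ a ∈ A, ∀ b ∈ B, (a, b) ∈ unitSquare ∧ r b a := fun a ha b hb =>
    hF.sub k (a, b) (hAB ▸ ⟨ha, hb⟩)
  have hk : F k ⊆ maxRect r B := by
    rw [hAB]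
    rintro ⟨a, b⟩ ⟨ha, hb⟩
    have h := (hmem a ha b hb).1
    exact ⟨⟨h.1, fun b' hb' => (hmem a ha b' hb').2⟩, h.2, fun a' ha' => ha'.2 b hb⟩
  have hfull := hF.law_maxRect_le hle hlt hfin hmin hpos hmax hk
  obtain ⟨⟨a₀, b₀⟩, h₀⟩ : (F k).Nonempty := by
    rw [nonempty_iff_ne_empty]; intro h; simp [h] at hpos
  rw [hAB] at h₀
  have hbdd : BddAbove B := ⟨a₀, fun b hb => hle _ _ (hmem a₀ h₀.1 b hb).2⟩
  set v := sSup B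
  have hsub : F k ⊆ Icc v 1 ×ˢ Icc 0 v := by
    rw [hAB]
    rintro ⟨a, b⟩ ⟨ha, hb⟩
    have h := (hmem a ha b hb).1
    exact ⟨⟨csSup_le ⟨b, hb⟩ fun b' hb' => hle _ _ (hmem a ha b' hb').2, h.1.2.le⟩,
      h.2.1, le_csSup hbdd hb⟩
  have h0v : 0 ≤ v := (hsub (hAB ▸ h₀)).2.1.trans (hsub (hAB ▸ h₀)).2.2
  have hv1 : v ≤ 1 := (hsub (hAB ▸ h₀)).1.1.trans (hsub (hAB ▸ h₀)).1.2
  have hvol : law (F k) ≤ ENNReal.ofReal (1 - v) * ENNReal.ofReal v := by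
    calc law (F k) ≤ volume (F k) := by rw [law_eq]; exact Measure.restrict_apply_le _ _
      _ ≤ volume (Icc v 1 ×ˢ Icc 0 v) := measure_mono hsub
      _ = _ := by rw [Measure.volume_eq_prod, Measure.prod_prod]; simp
  have hposE : 0 < law (F k) := (ENNReal.toReal_pos_iff.1 hpos).1
  -- For `v = 0` or `v = 1` the enclosing rectangle would be null, while `F k` has positive
  -- probability.
  have hv0' : 0 < v := by
    refine h0v.lt_of_ne fun h => ?_
    rw [← h] at hvol; simp at hvol; exact hposE.ne' hvol
  have hv1' : v < 1 := by
    refine hv1.lt_of_ne fun h => ?_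
    rw [h] at hvol; simp at hvol; exact hposE.ne' hvol
  refine ⟨v, ⟨hv0', hv1'⟩, k, isRectangleWithVertices_of_null hv0' hv1' hsub ?_⟩
  have hopen : Ioo v 1 ×ˢ Ioo 0 v ⊆ maxRect r B := by
    rintro ⟨a, b⟩ ⟨ha, hb⟩
    refine ⟨⟨⟨h0v.trans ha.1.le, ha.2⟩, fun b' hb' => hlt _ _ ((le_csSup hbdd hb').trans_lt ha.1)⟩,
      ⟨hb.1.le, hb.2.trans hv1'⟩, fun a' ha' => ?_⟩
    -- As `b < v`, some `b' ∈ B` exceeds `b`, and every `a'` in `upperPart r B` is at least `b'`.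
    obtain ⟨b', hb', hbb'⟩ := exists_lt_of_lt_csSup ⟨b₀, h₀.2⟩ hb.2
    exact hlt _ _ (hbb'.trans_le (hle _ _ (ha'.2 b' hb')))
  have hsq : Ioo v 1 ×ˢ Ioo 0 v ⊆ unitSquare := fun x hx => ⟨(hopen hx).1.1, (hopen hx).2.1⟩
  have hdiff : law (maxRect r B \ F k) = 0 := by
    rw [measure_sdiff hk (hF.measurableSet k).nullMeasurableSet (measure_ne_top _ _),
      tsub_eq_zero_iff_le]
    exact (ENNReal.toReal_le_toReal (measure_ne_top _ _) (measure_ne_top _ _)).1 hfull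
  have := measure_mono_null (sdiff_subset_sdiff_left (t := F k) hopen) hdiff
  rwa [law_eq, Measure.restrict_eq_self _ (sdiff_subset.trans hsq)] at this

end Optimal

theorem IsRectangleWithVertices.of_preimage_swap {R : Set (ℝ × ℝ)} {a b : ℝ × ℝ}
    (h : IsRectangleWithVertices (Prod.swap ⁻¹' R) a b) :
    IsRectangleWithVertices R a.swap b.swap := by
  have hu : Prod.swap ⁻¹' (uIcc a b) = uIcc a.swap b.swap := by
    rcases a with ⟨a1, a2⟩; rcases b with ⟨b1, b2⟩
    simp [← uIcc_prod_uIcc, preimage_swap_prod]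
  obtain ⟨hc, hn⟩ := h
  constructor
  · have h2 : closure (Prod.swap ⁻¹' R) = Prod.swap ⁻¹' closure R :=
      ((Homeomorph.prodComm ℝ ℝ).preimage_closure R).symm
    rw [← hu, ← hc, h2]; ext x; simp
  · have hmp : MeasurePreserving (Prod.swap : ℝ × ℝ → ℝ × ℝ) volume volume :=
      ⟨measurable_swap, Measure.prod_swap⟩
    rw [← hmp.measure_preimage_equiv (f := MeasurableEquiv.prodComm), ← hu]
    exact hn

/-! ### The dyadic partition has finite entropy -/

/-- The dyadic interval `[j/2^k, (j+1)/2^k)` of the unit interval. -/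
def dyadicPart (k j : ℕ) : Set ℝ := {x ∈ Ico (0 : ℝ) 1 | ⌊2 ^ k * x⌋₊ = j}

/-- The dyadic square of level `k` and position `j` below the diagonal. -/
def dyadicCell (k j : ℕ) : Set (ℝ × ℝ) :=
  dyadicPart (k + 1) (2 * j + 1) ×ˢ dyadicPart (k + 1) (2 * j)

theorem dyadicPart_subset (k j : ℕ) :
    dyadicPart k j ⊆ Icc ((j : ℝ) / 2 ^ k) ((j + 1) / 2 ^ k) := by
  rintro x ⟨hx, rfl⟩
  have h2 : (0 : ℝ) < 2 ^ k := by positivity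
  rw [mem_Icc, div_le_iff₀' h2, le_div_iff₀' h2]
  exact ⟨Nat.floor_le (mul_nonneg h2.le hx.1), (Nat.lt_floor_add_one _).le⟩

theorem isUnionOfIntervals_dyadicPart (k j : ℕ) : IsUnionOfIntervals (dyadicPart k j) := by
  refine isUnionOfIntervals_of_ordConnected (ordConnected_Ico.inter ?_)
  have hm : Monotone fun x : ℝ => ⌊2 ^ k * x⌋₊ := fun x y h => by
    dsimp only; gcongr
  exact (ordConnected_singleton (a := j)).preimage_mono hm

theorem law_dyadicCell_le (k j : ℕ) : law.real (dyadicCell k j) ≤ (1 / 4) ^ (k + 1) := by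
  have hv : ∀ i, volume (Icc ((i : ℝ) / 2 ^ (k + 1)) ((i + 1) / 2 ^ (k + 1))) =
      ENNReal.ofReal ((1 / 2) ^ (k + 1)) := fun i => by
    rw [Real.volume_Icc]; congr 1; rw [one_div_pow]; ring
  have h : law (dyadicCell k j) ≤ ENNReal.ofReal ((1 / 4) ^ (k + 1)) := by
    calc law (dyadicCell k j) ≤ volume (dyadicCell k j) := by
          rw [law_eq]; exact Measure.restrict_apply_le _ _
      _ ≤ volume (Icc (((2 * j + 1 : ℕ) : ℝ) / 2 ^ (k + 1)) (((2 * j + 1 : ℕ) + 1) / 2 ^ (k + 1)) ×ˢ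
          Icc (((2 * j : ℕ) : ℝ) / 2 ^ (k + 1)) (((2 * j : ℕ) + 1) / 2 ^ (k + 1))) :=
        measure_mono (prod_mono (dyadicPart_subset _ _) (dyadicPart_subset _ _))
      _ = _ := by
        rw [Measure.volume_eq_prod, Measure.prod_prod, hv, hv, ← ENNReal.ofReal_mul (by positivity),
          ← mul_pow]
        norm_num
  exact ENNReal.toReal_le_of_le_ofReal (by positivity) h

/-- The floors are binary prefixes of `x`; the division drops the last `l - k` digits. -/
theorem floor_two_pow_div (x : ℝ) {k l : ℕ} (h : k ≤ l) :
    ⌊2 ^ l * x⌋₊ / 2 ^ (l - k) = ⌊2 ^ k * x⌋₊ := by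
  rw [← Nat.cast_ofNat (R := ℝ) (n := 2), ← Nat.floor_div_natCast]
  congr 1
  obtain ⟨m, rfl⟩ := Nat.exists_eq_add_of_le h
  simp only [add_tsub_cancel_left, pow_add]
  push_cast
  field_simp

/-- The level of a cell records where the binary expansions of the two coordinates first differ. If
`k < l`, the cell of level `l` forces equal prefixes of length `l ≥ k + 1`, whereas the cell of
level `k` has the distinct prefixes `2i + 1` and `2i` of length `k + 1`. -/
theorem dyadicCell_level_le {k l i j : ℕ} {x : ℝ × ℝ} (hk : x ∈ dyadicCell k i)
    (hl : x ∈ dyadicCell l j) : l ≤ k := by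
  by_contra! h
  have h1 := floor_two_pow_div x.1 (Nat.succ_le_succ h.le)
  have h2 := floor_two_pow_div x.2 (Nat.succ_le_succ h.le)
  rw [hk.1.2, hl.1.2] at h1
  rw [hk.2.2, hl.2.2] at h2
  obtain ⟨m, rfl⟩ := Nat.exists_eq_add_of_lt h
  have : k + m + 1 + 1 - (k + 1) = m + 1 := by omega
  rw [Nat.succ_eq_add_one, Nat.succ_eq_add_one, this, pow_succ', ← Nat.div_div_eq_div_mul] at h1 h2
  have h3 : (2 * j + 1) / 2 = j := by omega
  have h4 : 2 * j / 2 = j := by omega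
  rw [h3] at h1; rw [h4] at h2; omega

theorem exists_mem_dyadicCell {x : ℝ × ℝ} (hx : x ∈ unitSquare) (h : x.2 < x.1) :
    ∃ k j, j < 2 ^ k ∧ x ∈ dyadicCell k j := by
  have hex : ∃ k, ⌊2 ^ k * x.1⌋₊ ≠ ⌊2 ^ k * x.2⌋₊ := by
    obtain ⟨k, hk⟩ := pow_unbounded_of_one_lt (1 / (x.1 - x.2)) (one_lt_two (α := ℝ))
    refine ⟨k, fun he => ?_⟩
    rw [div_lt_iff₀ (sub_pos.2 h)] at hk
    have h1 := Nat.floor_le (mul_nonneg (by positivity : (0 : ℝ) ≤ 2 ^ k) hx.2.1)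
    have h2 := Nat.lt_floor_add_one ((2 : ℝ) ^ k * x.1)
    have h3 := Nat.floor_le (mul_nonneg (by positivity : (0 : ℝ) ≤ 2 ^ k) hx.1.1)
    have h4 := Nat.lt_floor_add_one ((2 : ℝ) ^ k * x.2)
    rw [he] at h2
    nlinarith
  classical
  -- At the least level where the prefixes differ they share their half, so they are `2j + 1` and
  -- `2j`; this level is not `0`, where both prefixes vanish.
  obtain ⟨n, hn, hmin⟩ : ∃ n, ⌊2 ^ n * x.1⌋₊ ≠ ⌊2 ^ n * x.2⌋₊ ∧
      ∀ m < n, ⌊2 ^ m * x.1⌋₊ = ⌊2 ^ m * x.2⌋₊ :=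
    ⟨Nat.find hex, Nat.find_spec hex, fun m hm => not_not.1 (Nat.find_min hex hm)⟩
  obtain _ | k := n
  · refine absurd ?_ hn
    rw [pow_zero, one_mul, one_mul, Nat.floor_eq_zero.2 hx.1.2, Nat.floor_eq_zero.2 hx.2.2]
  have he := hmin k k.lt_succ_self
  have h1 := floor_two_pow_div x.1 k.le_succ
  have h2 := floor_two_pow_div x.2 k.le_succ
  simp only [Nat.succ_eq_add_one, add_tsub_cancel_left, pow_one] at h1 h2
  have hm : ⌊2 ^ (k + 1) * x.2⌋₊ ≤ ⌊2 ^ (k + 1) * x.1⌋₊ := by gcongr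
  refine ⟨k, ⌊2 ^ k * x.1⌋₊, ?_, ⟨hx.1, by omega⟩, ⟨hx.2, by omega⟩⟩
  rw [Nat.floor_lt (mul_nonneg (by positivity) hx.1.1)]
  push_cast
  have := hx.1.2
  have h2k : (0 : ℝ) < 2 ^ k := by positivity
  nlinarith

/-- The dyadic squares below the diagonal as a sequence. -/
def dyadicFamily (n : ℕ) : Set (ℝ × ℝ) :=
  if n.unpair.2 < 2 ^ n.unpair.1 then dyadicCell n.unpair.1 n.unpair.2 else ∅

theorem isTrianglePartition_dyadicFamily {r : ℝ → ℝ → Prop} (hlt : ∀ b a, b < a → r b a) :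
    IsTrianglePartition r dyadicFamily where
  rect n := by
    unfold dyadicFamily
    split_ifs
    · exact ⟨_, _, isUnionOfIntervals_dyadicPart _ _, isUnionOfIntervals_dyadicPart _ _, rfl⟩
    · exact isCombRectangle_empty
  sub n x hx := by
    unfold dyadicFamily at hx
    split_ifs at hx
    · refine ⟨⟨hx.1.1, hx.2.1⟩, hlt _ _ (lt_of_not_ge fun h => ?_)⟩
      have : ⌊2 ^ (n.unpair.1 + 1) * x.1⌋₊ ≤ ⌊2 ^ (n.unpair.1 + 1) * x.2⌋₊ := by gcongr
      rw [hx.1.2, hx.2.2] at this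
      omega
    · exact hx.elim
  disj m n hmn := by
    rw [disjoint_left]
    intro x hm hn
    unfold dyadicFamily at hm hn
    split_ifs at hm hn
    · have hl := (dyadicCell_level_le hm hn).antisymm (dyadicCell_level_le hn hm)
      refine hmn ?_
      have h1 := hm.2.2
      have h2 := hn.2.2
      rw [hl] at h2
      have hp : m.unpair = n.unpair := Prod.ext hl.symm (by omega)
      rw [← Nat.pair_unpair m, hp, Nat.pair_unpair]
    all_goals first | exact hm.elim | exact hn.elim
  cover := by
    rw [law_eq]
    filter_upwards [ae_restrict_mem measurableSet_unitSquare] with x hx h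
    obtain ⟨k, j, hj, hxm⟩ := exists_mem_dyadicCell hx h
    exact mem_iUnion.2 ⟨Nat.pair k j, by simpa [dyadicFamily, hj] using hxm⟩

/-- `negMulLog` is not monotone on `[0,1]`, so an upper bound on a probability is turned into an
entropy bound through the tangent at `q`. -/
theorem negMulLog_le_of_le {p q : ℝ} (hp : 0 ≤ p) (hpq : p ≤ q) (hq : 0 < q) (hq1 : q ≤ 1) :
    Real.negMulLog p ≤ q * (1 - Real.log q) := by
  have h := negMulLog_le_tangent hq hp
  have := Real.log_nonpos hq.le hq1
  simp only [Real.negMulLog] at h ⊢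
  nlinarith

theorem cellEntropy_dyadicCell_le (k j : ℕ) :
    cellEntropy (dyadicCell k j) ≤
      ENNReal.ofReal ((1 / 4) ^ (k + 1) * (1 + (k + 1) * Real.log 4) / Real.log 2) := by
  rw [cellEntropy_eq]
  have hl : (0 : ℝ) < Real.log 2 := Real.log_pos one_lt_two
  gcongr
  have h := negMulLog_le_of_le measureReal_nonneg (law_dyadicCell_le k j) (by positivity)
    (pow_le_one₀ (by norm_num) (by norm_num))
  refine h.trans_eq ?_
  rw [Real.log_pow, one_div, Real.log_inv]
  push_cast
  ring

/-- Level `k` has `2 ^ k` cells, each contributing `O(k / 4 ^ k)`, so the levels are dominated by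
the convergent series of `k / 2 ^ k`. -/
theorem entropy_dyadicFamily_ne_top : ∑' n, cellEntropy (dyadicFamily n) ≠ ⊤ := by
  have he : cellEntropy ∅ = 0 := by simp [cellEntropy]
  have hd : ∀ k j, dyadicFamily (Nat.pairEquiv (k, j)) =
      if j < 2 ^ k then dyadicCell k j else ∅ := fun k j => by
    change dyadicFamily (Nat.pair k j) = _
    simp [dyadicFamily]
  have hl : (0 : ℝ) < Real.log 2 := Real.log_pos one_lt_two
  have hl4 : (0 : ℝ) < Real.log 4 := Real.log_pos (by norm_num)
  set c : ℕ → ℝ := fun k => (1 / 4) ^ (k + 1) * (1 + (k + 1) * Real.log 4) / Real.log 2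
  have hc : ∀ k, 0 ≤ c k := fun k => by positivity
  have hsum : Summable fun k : ℕ => 2 ^ k * c k := by
    have h0 : Summable fun k : ℕ => (1 / 2 : ℝ) ^ k :=
      summable_geometric_of_lt_one (by norm_num) (by norm_num)
    have h1 : Summable fun k : ℕ => (k : ℝ) ^ 1 * (1 / 2 : ℝ) ^ k :=
      summable_pow_mul_geometric_of_norm_lt_one 1 (by norm_num)
    refine ((h0.mul_left ((1 + Real.log 4) / (4 * Real.log 2))).add
      (h1.mul_left (Real.log 4 / (4 * Real.log 2)))).congr fun k => ?_
    have h4 : (1 / 4 : ℝ) ^ k = (1 / 2) ^ k * (1 / 2) ^ k := by rw [← mul_pow]; norm_num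
    have h2 : (2 : ℝ) ^ k * (1 / 2) ^ k = 1 := by rw [← mul_pow]; norm_num
    simp only [c, pow_succ, h4]
    field_simp
    linear_combination (-(1 + (k + 1) * Real.log 4)) * h2
  have hbound : ∑' n, cellEntropy (dyadicFamily n) ≤ ∑' k, ENNReal.ofReal (2 ^ k * c k) := by
    rw [← Nat.pairEquiv.tsum_eq (fun n => cellEntropy (dyadicFamily n)),
      ENNReal.tsum_prod (f := fun k j => cellEntropy (dyadicFamily (Nat.pairEquiv (k, j))))]
    refine ENNReal.tsum_le_tsum fun k => ?_
    rw [tsum_eq_sum (s := Finset.range (2 ^ k)) fun j hj => by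
      rw [Finset.mem_range] at hj
      rw [hd, if_neg hj, he]]
    calc _ ≤ ∑ j ∈ Finset.range (2 ^ k), ENNReal.ofReal (c k) := by
          refine Finset.sum_le_sum fun j hj => ?_
          rw [Finset.mem_range] at hj
          rw [hd, if_pos hj]
          exact cellEntropy_dyadicCell_le k j
      _ = _ := by
        rw [Finset.sum_const, Finset.card_range, ENNReal.ofReal_mul (by positivity), nsmul_eq_mul,
          ENNReal.ofReal_pow (by norm_num)]
        simp
  refine ne_top_of_le_ne_top ?_ hbound
  rw [← ENNReal.ofReal_tsum_of_nonneg (fun k => mul_nonneg (by positivity) (hc k)) hsum]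
  exact ENNReal.ofReal_ne_top

/-! ### Finiteness of the minimum and the main theorem -/

theorem ZeroErrorPartition.MinimizesEntropy.ne_top {𝒮 : ZeroErrorPartition}
    (h : 𝒮.MinimizesEntropy) : 𝒮.entropy ≠ ⊤ := by
  refine ne_top_of_le_ne_top ?_ (h (ofTriangles
    (isTrianglePartition_dyadicFamily fun _ _ => le_of_lt)
    (isTrianglePartition_dyadicFamily fun _ _ => id)))
  rw [entropy_ofTriangles]
  exact ENNReal.add_ne_top.2 ⟨entropy_dyadicFamily_ne_top, entropy_dyadicFamily_ne_top⟩

end ComparisonPartition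

theorem mainTheorem4 (𝒮 : ComparisonPartition.ZeroErrorPartition)
    (h𝒮 : 𝒮.MinimizesEntropy) :
    ∃ u v : ℝ, (0 < u ∧ u < 1) ∧ (0 < v ∧ v < 1) ∧
      (∃ i, ComparisonPartition.IsRectangleWithVertices (𝒮.P i) (1, 0) (v, v)) ∧
      (∃ j, ComparisonPartition.IsRectangleWithVertices (𝒮.Q j) (0, 1) (u, u)) := by
  have hfin := h𝒮.ne_top
  rw [𝒮.entropy_eq] at hfin
  obtain ⟨hfP, hfQ⟩ := ENNReal.add_ne_top.1 hfin
  -- Each triangle is optimal by itself: exchange one family, keep the other, and cancel the finite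
  -- entropy of the one kept.
  obtain ⟨v, hv, hP⟩ := 𝒮.isTrianglePartition_P.exists_isRectangleWithVertices
    (fun _ _ => id) (fun _ _ => le_of_lt) hfP fun G hG => by
      have h := h𝒮 (ComparisonPartition.ofTriangles hG 𝒮.isTrianglePartition_Q)
      rw [𝒮.entropy_eq, ComparisonPartition.entropy_ofTriangles] at h
      exact (ENNReal.add_le_add_iff_right hfQ).1 h
  obtain ⟨u, hu, j, hQ⟩ := 𝒮.isTrianglePartition_Q.exists_isRectangleWithVertices
    (fun _ _ => le_of_lt) (fun _ _ => id) hfQ fun G hG => by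
      have h := h𝒮 (ComparisonPartition.ofTriangles 𝒮.isTrianglePartition_P hG)
      rw [𝒮.entropy_eq, ComparisonPartition.entropy_ofTriangles] at h
      exact (ENNReal.add_le_add_iff_left hfP).1 h
  exact ⟨u, v, hu, hv, hP, j, hQ.of_preimage_swap⟩
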